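/- Let $K_1,K_2,n_1,n_2,m_1,m_2$ be natural numbers. Let $p_{C_1,C_2}$ be a probability mass function on $\{1,\dots,K_1\}\times\{1,\dots,K_2\}$ and $\mathcal S=\{(i,k): p_{C_1,C_2}(i,k)>0\}$. For all $(i,k)$ let $\boldsymbol\mu^{(ik)}\in\mathbb R^{n_1+n_2}$ and let $$\boldsymbol\Sigma_{\mathbf x}^{(ik)}=\begin{bmatrix}\boldsymbol\Sigma_{\mathbf x_1}^{(ik)}&\boldsymbol\Sigma_{\mathbf x_{12}}^{(ik)}\\ \boldsymbol\Sigma_{\mathbf x_{21}}^{(ik)}&\boldsymbol\Sigma_{\mathbf x_2}^{(ik)}\end{bmatrix}$$ be a (possibly singular) positive semidefinite matrix, with diagonal blocks of sizes $n_1\times n_1$ and $n_2\times n_2$. Put $r_{\mathbf x}^{(ik)}=\operatorname{rank}\boldsymbol\Sigma_{\mathbf x}^{(ik)}$, $r_{\mathbf x_1}^{(ik)}=\operatorname{rank}\boldsymbol\Sigma_{\mathbf x_1}^{(ik)}$ and $r_{\mathbf x_2}^{(ik)}=\operatorname{rank}\boldsymbol\Sigma_{\mathbf x_2}^{(ik)}$.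 Let $\mathbf x=(\mathbf x_1,\mathbf x_2)\in\mathbb R^{n_1}\times\mathbb R^{n_2}$ follow the Gaussian mixture model: $(C_1,C_2)\sim p_{C_1,C_2}$ and, given $(C_1,C_2)=(i,k)$, $\mathbf x\sim\mathcal N(\boldsymbol\mu^{(ik)},\boldsymbol\Sigma_{\mathbf x}^{(ik)})$. Let $\boldsymbol\Phi_1\in\mathbb R^{m_1\times n_1}$ and $\boldsymbol\Phi_2\in\mathbb R^{m_2\times n_2}$ be independent random matrices, each left rotation-invariant, i.e. its entries have a joint probability density $q$ with $q(\boldsymbol\Theta\mathbf A)=q(\mathbf A)$ for every orthogonal matrix $\boldsymbol\Theta$ (for almost every $\mathbf A$). Given $\boldsymbol\Phi_1,\boldsymbol\Phi_2$ and $\sigma^2>0$, observe $\mathbf y_1=\boldsymbol\Phi_1\mathbf x_1+\mathbf w_1$ and $\mathbf y_2=\boldsymbol\Phi_2\mathbf x_2+\mathbf w_2$, where $\mathbf w=(\mathbf w_1,\mathbf w_2)\sim\mathcal N(\mathbf 0,\sigma^2\mathbf I)$ is independent of $\mathbf x$; neither $\mathbf x$ nor $\mathbf w$ depends on the realization of $(\boldsymbol\Phi_1,\boldsymbol\Phi_2)$.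 With $\mathbf y=(\mathbf y_1,\mathbf y_2)$, let $$\mathrm{MMSE}_{1,2|1,2}(\sigma^2)=\mathbb E\big[\|\mathbf x-\mathbb E[\mathbf x\mid\mathbf y]\|^2\big],$$ where the expectation is over $(\mathbf x,\mathbf w)$, with $\boldsymbol\Phi_1,\boldsymbol\Phi_2$ fixed. Then, with probability $1$ over the draw of $(\boldsymbol\Phi_1,\boldsymbol\Phi_2)$: if $$m_1>r_{\mathbf x}^{(ik)}-r_{\mathbf x_2}^{(ik)},\qquad m_2>r_{\mathbf x}^{(ik)}-r_{\mathbf x_1}^{(ik)},\qquad m_1+m_2>r_{\mathbf x}^{(ik)}\qquad\text{for all }(i,k)\in\mathcal S,$$ then $\lim_{\sigma^2\to0^+}\mathrm{MMSE}_{1,2|1,2}(\sigma^2)=0$. -/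

import Mathlib

open MeasureTheory ProbabilityTheory Filter Topology
open scoped ENNReal Matrix

noncomputable section

/-- The Borel (product) σ-algebra on real matrices, generated by the entries. -/
instance matrixMeasurableSpace (m n : ℕ) : MeasurableSpace (Matrix (Fin m) (Fin n) ℝ) :=
  inferInstanceAs (MeasurableSpace (Fin m → Fin n → ℝ))

/-- Lebesgue measure on `m × n` real matrices, i.e. on their `m * n` real entries. -/
def matrixLebesgue (m n : ℕ) : Measure (Matrix (Fin m) (Fin n) ℝ) :=
  Measure.pi fun _ : Fin m => Measure.pi fun _ : Fin n => (volume : Measure ℝ)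

/-- The random matrix `Φ` is left rotation-invariant: its entries have a joint probability density
`p` which satisfies `p (Θ * A) = p A` for every orthogonal matrix `Θ`. As a density is determined
only up to null sets, the identity is required for almost every `A`. -/
def IsLeftRotationInvariant {Ω : Type*} [MeasurableSpace Ω] (P : Measure Ω) {m n : ℕ}
    (Φ : Ω → Matrix (Fin m) (Fin n) ℝ) : Prop :=
  Measurable Φ ∧ ∃ p : Matrix (Fin m) (Fin n) ℝ → ℝ≥0∞, Measurable p ∧
    P.map Φ = (matrixLebesgue m n).withDensity p ∧
    ∀ Θ ∈ Matrix.orthogonalGroup (Fin m) ℝ, ∀ᵐ A ∂(matrixLebesgue m n), p (Θ * A) = p A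

/-- The space of a pair of vectors `x = (x₁, x₂)` with `x₁ ∈ ℝᵃ` and `x₂ ∈ ℝᵇ`, with its
Euclidean norm. -/
abbrev PairVec (a b : ℕ) : Type := EuclideanSpace ℝ (Fin a ⊕ Fin b)

/-- The Gaussian mixture law of `x = (x₁, x₂)`: the pair of class labels `(C₁, C₂)` equals `(i, k)`
with probability `p (i, k)`, and `x` then has the law `N(μ i k, S i k)`. -/
def gmmLaw {K₁ K₂ n₁ n₂ : ℕ} (p : PMF (Fin K₁ × Fin K₂))
    (μ : Fin K₁ → Fin K₂ → PairVec n₁ n₂)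
    (S : Fin K₁ → Fin K₂ → Matrix (Fin n₁ ⊕ Fin n₂) (Fin n₁ ⊕ Fin n₂) ℝ) :
    Measure (PairVec n₁ n₂) :=
  ∑ i, ∑ k, p (i, k) • multivariateGaussian (μ i k) (S i k)

/-- The law of `w = (w₁, w₂) ~ N(0, v I)`, the noise of variance `v`. -/
def noiseLaw (m₁ m₂ : ℕ) (v : ℝ) : Measure (PairVec m₁ m₂) :=
  multivariateGaussian 0 (v • (1 : Matrix (Fin m₁ ⊕ Fin m₂) (Fin m₁ ⊕ Fin m₂) ℝ))

/-- The observation `y = Φ x + w`, where `Φ` is block diagonal with blocks `Φ₁` and `Φ₂`; that is,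
`y₁ = Φ₁ x₁ + w₁` and `y₂ = Φ₂ x₂ + w₂`. -/
def observe {m₁ m₂ n₁ n₂ : ℕ} (Φ₁ : Matrix (Fin m₁) (Fin n₁) ℝ) (Φ₂ : Matrix (Fin m₂) (Fin n₂) ℝ)
    (xw : PairVec n₁ n₂ × PairVec m₁ m₂) : PairVec m₁ m₂ :=
  WithLp.toLp 2 ((Matrix.fromBlocks Φ₁ 0 0 Φ₂) *ᵥ xw.1.ofLp) + xw.2

/-- The joint minimum mean square error `E ‖x - E[x | y]‖²` in the estimation of `x` of law `Q` from
`y = Φ x + w`, where the noise `w ~ N(0, v I)` is independent of `x`. The value is in `[0, ∞]`. -/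
def jointMMSE {m₁ m₂ n₁ n₂ : ℕ} (Q : Measure (PairVec n₁ n₂))
    (Φ₁ : Matrix (Fin m₁) (Fin n₁) ℝ) (Φ₂ : Matrix (Fin m₂) (Fin n₂) ℝ) (v : ℝ) : ℝ≥0∞ :=
  let M : Measure (PairVec n₁ n₂ × PairVec m₁ m₂) := Q.prod (noiseLaw m₁ m₂ v)
  let xhat : PairVec n₁ n₂ × PairVec m₁ m₂ → PairVec n₁ n₂ :=
    M[fun xw => xw.1 | MeasurableSpace.comap (observe Φ₁ Φ₂) inferInstance]
  ∫⁻ xw, ‖xw.1 - xhat xw‖ₑ ^ 2 ∂M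

end

/-! Write `T` for the noiseless map. The MMSE is at most `4` times the error of any estimator `f(y)`
with `f` bounded continuous, and that error tends to its noiseless value `E‖x - f(T x)‖²`. If `T` is
injective on a set of full measure, `x` is a measurable function of `T x`, which bounded continuous
`f` approximate in `L²` (`tendsto_jointMMSE_zero`).

To find that set, note that component `a` lives on the affine space `μ a + V a`, with `dim V a =
rank (S a)`. The rank conditions are strict, so they leave room for one extra dimension: a generic
`T` is injective on `V b ⊔ span {u}` for finitely many prescribed `u` (`ae_blockMap_injOn`, from the
row-by-row dimension count `ae_injOn_pair_of_finrank_le`). Take `u = x₀ - μ b` with `x₀` in support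
`a` but not in support `b`. Then `T x₀` avoids the image of support `b`, so almost every point of
component `a` does too, and points with equal images share a support
(`exists_measurableSet_injOn_gmmLaw`). -/

instance sigmaFinite_matrixLebesgue (m n : ℕ) : SigmaFinite (matrixLebesgue m n) :=
  inferInstanceAs (SigmaFinite (Measure.pi fun _ : Fin m =>
    Measure.pi fun _ : Fin n => (volume : Measure ℝ)))

/-! ### Injectivity of generic matrices on a subspace -/

section GenericInjectivity

/-- The bad parameters are the projection of a closed set along the compact unit sphere of `W`. This
supplies the measurability that Fubini needs below. -/
theorem isOpen_setOf_injOn_submodule {X E F : Type*} [TopologicalSpace X] [NormedAddCommGroup E]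
    [NormedSpace ℝ E] [FiniteDimensional ℝ E] [NormedAddCommGroup F] [NormedSpace ℝ F]
    (f : X → E →ₗ[ℝ] F) (hf : Continuous fun q : E × X => f q.2 q.1) (W : Submodule ℝ E) :
    IsOpen {x | ∀ w ∈ W, f x w = 0 → w = 0} := by
  have hK : IsCompact (Metric.sphere (0 : E) 1 ∩ (W : Set E)) :=
    (isCompact_sphere 0 1).inter_right W.closed_of_finiteDimensional
  have : CompactSpace (Metric.sphere (0 : E) 1 ∩ (W : Set E) : Set E) :=
    isCompact_iff_compactSpace.1 hK
  have hcl : IsClosed {q : (Metric.sphere (0 : E) 1 ∩ (W : Set E) : Set E) × X |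
      f q.2 q.1 = 0} :=
    isClosed_eq (hf.comp (by fun_prop :
      Continuous fun q : (Metric.sphere (0 : E) 1 ∩ (W : Set E) : Set E) × X =>
        ((q.1 : E), q.2))) continuous_const
  rw [← isClosed_compl_iff]
  convert isClosedMap_snd_of_compactSpace _ hcl using 1
  ext x
  simp only [Set.mem_compl_iff, Set.mem_ofPred_eq, not_forall, Set.mem_image, Prod.exists,
    exists_eq_right, Subtype.exists, Set.mem_inter_iff, mem_sphere_zero_iff_norm, SetLike.mem_coe]
  constructor
  · rintro ⟨w, hw, h0, hne⟩
    refine ⟨‖w‖⁻¹ • w, ⟨?_, W.smul_mem _ hw⟩, by simp [h0]⟩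
    rw [norm_smul, norm_inv, norm_norm, inv_mul_cancel₀ (norm_ne_zero_iff.2 hne)]
  · rintro ⟨w, ⟨hw1, hw⟩, h0⟩
    refine ⟨w, hw, h0, ?_⟩
    rintro rfl
    simp at hw1

theorem ae_pi_of_ae_cons {α : Type*} [MeasurableSpace α] {ν : Measure α} [SigmaFinite ν] {m : ℕ}
    {p : (Fin (m + 1) → α) → Prop} (hp : MeasurableSet {z | p z})
    (h : ∀ᵐ a ∂ν, ∀ᵐ A ∂(Measure.pi fun _ : Fin m => ν), p (Fin.cons a A)) :
    ∀ᵐ z ∂(Measure.pi fun _ : Fin (m + 1) => ν), p z := by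
  have hmp := measurePreserving_piFinSuccAbove (fun _ : Fin (m + 1) => ν) 0
  have key : ∀ᵐ q ∂(ν.prod (Measure.pi fun _ : Fin m => ν)),
      p ((MeasurableEquiv.piFinSuccAbove (fun _ : Fin (m + 1) => α) 0).symm q) := by
    rw [Measure.ae_prod_iff_ae_ae]
    · filter_upwards [h] with a ha
      filter_upwards [ha] with A hA
      simpa [MeasurableEquiv.piFinSuccAbove, Fin.insertNthEquiv] using hA
    · exact (MeasurableEquiv.measurable _) hp
  have := hmp.quasiMeasurePreserving.ae key
  simpa only [MeasurableEquiv.symm_apply_apply] using this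

theorem ae_dotProduct_ne_zero {n : ℕ} {x : Fin n → ℝ} (hx : x ≠ 0) :
    ∀ᵐ a ∂(Measure.pi fun _ : Fin n => (volume : Measure ℝ)), a ⬝ᵥ x ≠ 0 := by
  have h := Measure.addHaar_submodule (volume : Measure (Fin n → ℝ))
    (LinearMap.ker (dotProductBilin ℝ ℝ x)) ?_
  · rw [← volume_pi, ae_iff]
    convert h using 2
    ext a
    simp [dotProduct_comm]
  · intro h
    apply hx
    rw [LinearMap.ker_eq_top] at h
    have : x ⬝ᵥ x = 0 := by simpa using LinearMap.congr_fun h x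
    simpa using this

variable {E : Type*} [NormedAddCommGroup E] [NormedSpace ℝ E] [FiniteDimensional ℝ E]

theorem finrank_inf_ker_lt {W : Submodule ℝ E} {φ : E →ₗ[ℝ] ℝ} {w : E} (hw : w ∈ W)
    (h : φ w ≠ 0) :
    Module.finrank ℝ (W ⊓ LinearMap.ker φ : Submodule ℝ E) < Module.finrank ℝ W := by
  apply Submodule.finrank_lt_finrank_of_lt
  refine lt_of_le_of_ne inf_le_left fun he => h ?_
  rw [← he] at hw
  exact hw.2

theorem cons_mulVec_eq_zero {m n : ℕ} {a : Fin n → ℝ} {A : Matrix (Fin m) (Fin n) ℝ}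
    {x : Fin n → ℝ} :
    (Matrix.of (Fin.cons a A) : Matrix (Fin (m + 1)) (Fin n) ℝ) *ᵥ x = 0 ↔
      a ⬝ᵥ x = 0 ∧ A *ᵥ x = 0 := by
  simp only [funext_iff, Fin.forall_fin_succ]
  rfl

/-- If `L w ≠ 0` for one `w ∈ W`, the rows orthogonal to `L w` form a null hyperplane; every other
row cuts the dimension of `W`. -/
theorem ae_row_inf_ker {n : ℕ} (L : E →ₗ[ℝ] (Fin n → ℝ)) (W : Submodule ℝ E) :
    ∀ᵐ a ∂(Measure.pi fun _ : Fin n => (volume : Measure ℝ)),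
      W ≤ LinearMap.ker L ∨
      Module.finrank ℝ (W ⊓ LinearMap.ker (dotProductBilin ℝ ℝ a ∘ₗ L) : Submodule ℝ E) <
        Module.finrank ℝ W := by
  by_cases h : W ≤ LinearMap.ker L
  · simp [h]
  · obtain ⟨w, hw, hne⟩ := SetLike.not_le_iff_exists.1 h
    filter_upwards [ae_dotProduct_ne_zero (x := L w) (by simpa using hne)] with a ha
    exact Or.inr (finrank_inf_ker_lt hw (by simpa using ha))

theorem ae_injOn_of_finrank_le {m n : ℕ} (L : E →ₗ[ℝ] (Fin n → ℝ)) (W : Submodule ℝ E)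
    (hL : W ⊓ LinearMap.ker L = ⊥) (hW : Module.finrank ℝ W ≤ m) :
    ∀ᵐ A ∂(matrixLebesgue m n), ∀ w ∈ W, A *ᵥ L w = 0 → w = 0 := by
  induction m generalizing W with
  | zero =>
    refine ae_of_all _ fun A w hw _ => ?_
    have : W = ⊥ := Submodule.finrank_eq_zero.1 (by omega)
    simpa [this] using hw
  | succ m ih =>
    apply ae_pi_of_ae_cons
    · exact (isOpen_setOf_injOn_submodule
        (fun A : Fin (m + 1) → Fin n → ℝ => (Matrix.mulVecLin (Matrix.of A)) ∘ₗ L)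
        (by
          have := L.continuous_of_finiteDimensional
          exact Continuous.matrix_mulVec (A := fun q : E × (Fin (m + 1) → Fin n → ℝ) =>
            Matrix.of q.2) continuous_snd (this.comp continuous_fst))
        W).measurableSet
    · filter_upwards [ae_row_inf_ker L W] with a ha
      have hd : Module.finrank ℝ
          (W ⊓ LinearMap.ker (dotProductBilin ℝ ℝ a ∘ₗ L) : Submodule ℝ E) ≤ m := by
        rcases ha with ha | ha
        · rw [inf_eq_left.2 ha] at hL
          rw [hL, bot_inf_eq]
          simp
        · omega
      filter_upwards [ih (W ⊓ LinearMap.ker (dotProductBilin ℝ ℝ a ∘ₗ L))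
        (by rw [inf_right_comm, hL, bot_inf_eq]) hd] with A hA w hw h0
      obtain ⟨h1, h2⟩ := cons_mulVec_eq_zero.1 h0
      exact hA w ⟨hw, by simpa using h1⟩ h2

theorem measurableSet_setOf_injOn_pair {m₁ m₂ n₁ n₂ : ℕ} (L₁ : E →ₗ[ℝ] (Fin n₁ → ℝ))
    (L₂ : E →ₗ[ℝ] (Fin n₂ → ℝ)) (W : Submodule ℝ E) :
    MeasurableSet {A : Matrix (Fin m₁) (Fin n₁) ℝ × Matrix (Fin m₂) (Fin n₂) ℝ |
      ∀ w ∈ W, A.1 *ᵥ L₁ w = 0 → A.2 *ᵥ L₂ w = 0 → w = 0} := by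
  have c₁ := L₁.continuous_of_finiteDimensional
  have c₂ := L₂.continuous_of_finiteDimensional
  have hopen := isOpen_setOf_injOn_submodule
    (fun A : (Fin m₁ → Fin n₁ → ℝ) × (Fin m₂ → Fin n₂ → ℝ) =>
      ((Matrix.mulVecLin (Matrix.of A.1)) ∘ₗ L₁).prod ((Matrix.mulVecLin (Matrix.of A.2)) ∘ₗ L₂))
    (by
      refine Continuous.prodMk ?_ ?_
      · exact Continuous.matrix_mulVec (A := fun q : E × ((Fin m₁ → Fin n₁ → ℝ) ×
          (Fin m₂ → Fin n₂ → ℝ)) => Matrix.of q.2.1) (by fun_prop) (c₁.comp continuous_fst)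
      · exact Continuous.matrix_mulVec (A := fun q : E × ((Fin m₁ → Fin n₁ → ℝ) ×
          (Fin m₂ → Fin n₂ → ℝ)) => Matrix.of q.2.2) (by fun_prop) (c₂.comp continuous_fst)) W
  simp only [LinearMap.prod_apply, Function.prod, Prod.mk_eq_zero, LinearMap.comp_apply,
    Matrix.mulVecLin_apply, and_imp] at hopen
  exact hopen.measurableSet

/-- A pair of generic matrices, each of which sees one of two projections of a vector, is jointly
injective on a subspace whose dimension, and those of its intersections with the kernels of the
projections, are not larger than the number of rows available. -/
theorem ae_injOn_pair_of_finrank_le {m₁ m₂ n₁ n₂ : ℕ} (L₁ : E →ₗ[ℝ] (Fin n₁ → ℝ))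
    (L₂ : E →ₗ[ℝ] (Fin n₂ → ℝ)) (W : Submodule ℝ E)
    (hL : LinearMap.ker L₁ ⊓ LinearMap.ker L₂ = ⊥)
    (h₁ : Module.finrank ℝ (W ⊓ LinearMap.ker L₂ : Submodule ℝ E) ≤ m₁)
    (h₂ : Module.finrank ℝ (W ⊓ LinearMap.ker L₁ : Submodule ℝ E) ≤ m₂)
    (hW : Module.finrank ℝ W ≤ m₁ + m₂) :
    ∀ᵐ A₁ ∂(matrixLebesgue m₁ n₁), ∀ᵐ A₂ ∂(matrixLebesgue m₂ n₂),
      ∀ w ∈ W, A₁ *ᵥ L₁ w = 0 → A₂ *ᵥ L₂ w = 0 → w = 0 := by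
  induction m₁ generalizing W with
  | zero =>
    refine ae_of_all _ fun A₁ => ?_
    filter_upwards [ae_injOn_of_finrank_le L₂ W (Submodule.finrank_eq_zero.1 (by omega))
      (by omega : Module.finrank ℝ W ≤ m₂)] with A₂ hA₂ w hw _ h
    exact hA₂ w hw h
  | succ m₁ ih =>
    apply ae_pi_of_ae_cons
    -- The good `A₁` are those whose section of bad `A₂` has measure zero.
    · exact measurable_measure_prodMk_left (ν := matrixLebesgue m₂ n₂)
        (measurableSet_setOf_injOn_pair L₁ L₂ W).compl (measurableSet_singleton 0)
    -- One new row must lower both `W` and `W ⊓ ker L₂`, as both bounds drop by one. When it cannot,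
    -- `L₁` vanishes on the space: then `W ⊓ ker L₂` is zero, or `W = W ⊓ ker L₁` already has
    -- dimension at most `m₂`.
    · filter_upwards [ae_row_inf_ker L₁ W, ae_row_inf_ker L₁ (W ⊓ LinearMap.ker L₂)] with a ha hb
      refine (ih (W ⊓ LinearMap.ker (dotProductBilin ℝ ℝ a ∘ₗ L₁)) ?_ ?_ ?_).mono ?_
      · rcases hb with hb | hb
        · have : W ⊓ LinearMap.ker L₂ = ⊥ :=
            le_bot_iff.1 (hL ▸ le_inf hb inf_le_right)
          rw [inf_right_comm, this, bot_inf_eq]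
          simp
        · rw [inf_right_comm]
          omega
      · exact (Submodule.finrank_mono (inf_le_inf_right _ inf_le_left)).trans h₂
      · rcases ha with ha | ha
        · have := (Submodule.finrank_mono (inf_le_left :
            W ⊓ LinearMap.ker (dotProductBilin ℝ ℝ a ∘ₗ L₁) ≤ W))
          rw [inf_eq_left.2 ha] at h₂
          omega
        · omega
      · intro A₁ hA₁
        filter_upwards [hA₁] with A₂ hA₂ w hw h0 h0'
        obtain ⟨h1, h2⟩ := cons_mulVec_eq_zero.1 h0
        exact hA₂ w ⟨hw, by simpa using h1⟩ h2 h0'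

end GenericInjectivity

/-! ### Affine supports of singular Gaussian laws -/

section GaussianSupport

open scoped MatrixOrder

theorem ae_stdGaussian_ne {E : Type*} [NormedAddCommGroup E] [InnerProductSpace ℝ E]
    [FiniteDimensional ℝ E] [MeasurableSpace E] [BorelSpace E] {φ : StrongDual ℝ E} (hφ : φ ≠ 0)
    (c : ℝ) : ∀ᵐ z ∂(stdGaussian E), φ z ≠ c := by
  have hmap := IsGaussian.map_eq_gaussianReal (μ := stdGaussian E) φ
  rw [variance_dual_stdGaussian] at hmap
  have hv : (‖φ‖ ^ 2).toNNReal ≠ 0 := by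
    simpa using hφ
  have := nullSingletonClass_gaussianReal (μ := (stdGaussian E)[φ]) hv
  rw [← hmap] at this
  have h0 : ∀ᵐ y ∂((stdGaussian E).map φ), y ≠ c := by
    rw [ae_iff]; simp
  exact ae_of_ae_map φ.continuous.aemeasurable h0

/-- Choose a functional vanishing on `U` but not at `c + T z₀`. Along `c + T z` it is either a
nonzero constant or a nondegenerate real Gaussian, which has no atom at `0`. -/
theorem ae_stdGaussian_notMem {E F : Type*} [NormedAddCommGroup E] [InnerProductSpace ℝ E]
    [FiniteDimensional ℝ E] [MeasurableSpace E] [BorelSpace E] [AddCommGroup F] [Module ℝ F]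
    (T : E →ₗ[ℝ] F) (U : Submodule ℝ F) (c : F) {z₀ : E} (h : c + T z₀ ∉ U) :
    ∀ᵐ z ∂(stdGaussian E), c + T z ∉ U := by
  obtain ⟨f, hf, hU⟩ := Submodule.exists_le_ker_of_notMem h
  by_cases h0 : LinearMap.toContinuousLinearMap (f ∘ₗ T) = 0
  · have h0' : ∀ z, f (T z) = 0 := fun z => by
      simpa using congrArg (fun g : StrongDual ℝ E => g z) h0
    refine ae_of_all _ fun z hz => hf ?_
    have := hU hz
    simpa [h0'] using this
  · filter_upwards [ae_stdGaussian_ne h0 (-f c)] with z hz hmem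
    apply hz
    have := hU hmem
    simp only [LinearMap.mem_ker, map_add] at this
    simp only [LinearMap.coe_toContinuousLinearMap', LinearMap.comp_apply]
    linarith

variable {ι : Type*} [Fintype ι] [DecidableEq ι]

/-- The direction of the affine support of the Gaussian law with covariance matrix `S`. -/
noncomputable def gaussianDirection (S : Matrix ι ι ℝ) : Submodule ℝ (EuclideanSpace ℝ ι) :=
  LinearMap.range (Matrix.toEuclideanCLM (𝕜 := ℝ) (CFC.sqrt S)).toLinearMap

theorem range_toEuclideanCLM_le_gaussianDirection {S : Matrix ι ι ℝ} (hS : S.PosSemidef) :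
    LinearMap.range (Matrix.toEuclideanCLM (𝕜 := ℝ) S).toLinearMap ≤ gaussianDirection S := by
  rintro _ ⟨x, rfl⟩
  refine ⟨Matrix.toEuclideanCLM (𝕜 := ℝ) (CFC.sqrt S) x, ?_⟩
  conv_rhs => rw [← CFC.sqrt_mul_sqrt_self S hS.nonneg, map_mul]
  rfl

theorem finrank_range_toEuclideanCLM (A : Matrix ι ι ℝ) :
    Module.finrank ℝ (LinearMap.range (Matrix.toEuclideanCLM (𝕜 := ℝ) A).toLinearMap) =
      A.rank := by
  rw [Matrix.rank_eq_finrank_range_toLin A (EuclideanSpace.basisFun ι ℝ).toBasis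
    (EuclideanSpace.basisFun ι ℝ).toBasis]
  rfl

theorem finrank_gaussianDirection {S : Matrix ι ι ℝ} (hS : S.PosSemidef) :
    Module.finrank ℝ (gaussianDirection S) = S.rank := by
  have h : (CFC.sqrt S)ᴴ * CFC.sqrt S = S := by
    have : (CFC.sqrt S)ᴴ = CFC.sqrt S := (CFC.sqrt_nonneg S).isSelfAdjoint
    rw [this, CFC.sqrt_mul_sqrt_self S hS.nonneg]
  rw [gaussianDirection, finrank_range_toEuclideanCLM, ← Matrix.rank_conjTranspose_mul_self, h]

theorem ae_multivariateGaussian_sub_mem (μ : EuclideanSpace ℝ ι) (S : Matrix ι ι ℝ) :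
    ∀ᵐ x ∂(multivariateGaussian μ S), x - μ ∈ gaussianDirection S := by
  rw [multivariateGaussian, ae_map_iff (by fun_prop)]
  · exact ae_of_all _ fun z => ⟨z, by simp⟩
  · exact ((gaussianDirection S).closed_of_finiteDimensional.preimage
      (by fun_prop : Continuous fun x => x - μ)).measurableSet

theorem ae_multivariateGaussian_notMem {F : Type*} [NormedAddCommGroup F] [NormedSpace ℝ F]
    [FiniteDimensional ℝ F] (μ : EuclideanSpace ℝ ι) (S : Matrix ι ι ℝ)
    (T : EuclideanSpace ℝ ι →L[ℝ] F) (U : Submodule ℝ F) (b : F) {x₀ : EuclideanSpace ℝ ι}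
    (hx₀ : x₀ - μ ∈ gaussianDirection S) (h : T x₀ - b ∉ U) :
    ∀ᵐ x ∂(multivariateGaussian μ S), T x - b ∉ U := by
  rw [multivariateGaussian, ae_map_iff (by fun_prop)]
  · obtain ⟨z₀, hz₀⟩ := hx₀
    have := ae_stdGaussian_notMem
      (T.toLinearMap ∘ₗ (Matrix.toEuclideanCLM (𝕜 := ℝ) (CFC.sqrt S)).toLinearMap) U (T μ - b)
      (z₀ := z₀) (by
        rw [LinearMap.comp_apply, hz₀]
        convert h using 1
        simp)
    filter_upwards [this] with z hz
    convert hz using 1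
    simp only [map_add, LinearMap.comp_apply, ContinuousLinearMap.coe_coe]
    abel_nf
  · exact (U.closed_of_finiteDimensional.preimage
      (by fun_prop : Continuous fun x => T x - b)).measurableSet.compl

theorem multivariateGaussian_zero_smul_one {v : ℝ} (hv : 0 ≤ v) :
    multivariateGaussian (0 : EuclideanSpace ℝ ι) (v • (1 : Matrix ι ι ℝ)) =
      (stdGaussian (EuclideanSpace ℝ ι)).map fun z => √v • z := by
  have h : CFC.sqrt (v • (1 : Matrix ι ι ℝ)) = √v • (1 : Matrix ι ι ℝ) := by
    apply CFC.sqrt_unique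
    · rw [smul_mul_smul_comm, Real.mul_self_sqrt hv, one_mul]
    · exact smul_nonneg (Real.sqrt_nonneg v) zero_le_one
  rw [multivariateGaussian, h]
  simp

end GaussianSupport

/-! ### Vanishing noise and the MMSE -/

section LowNoise

variable {m₁ m₂ n₁ n₂ : ℕ}

/-- The linear map `x ↦ (Φ₁ x₁, Φ₂ x₂)`. -/
noncomputable def blockMap (Φ₁ : Matrix (Fin m₁) (Fin n₁) ℝ) (Φ₂ : Matrix (Fin m₂) (Fin n₂) ℝ) :
    PairVec n₁ n₂ →L[ℝ] PairVec m₁ m₂ :=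
  LinearMap.toContinuousLinearMap (Matrix.toLpLin 2 2 (Matrix.fromBlocks Φ₁ 0 0 Φ₂))

theorem observe_eq (Φ₁ : Matrix (Fin m₁) (Fin n₁) ℝ) (Φ₂ : Matrix (Fin m₂) (Fin n₂) ℝ) :
    observe Φ₁ Φ₂ = fun xw => blockMap Φ₁ Φ₂ xw.1 + xw.2 := rfl

theorem continuous_observe (Φ₁ : Matrix (Fin m₁) (Fin n₁) ℝ) (Φ₂ : Matrix (Fin m₂) (Fin n₂) ℝ) :
    Continuous (observe Φ₁ Φ₂) := by
  rw [observe_eq]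
  fun_prop

theorem eLpNorm_two_sq {α E : Type*} [MeasurableSpace α] [NormedAddCommGroup E] (f : α → E)
    (ν : Measure α) : eLpNorm f 2 ν ^ 2 = ∫⁻ x, ‖f x‖ₑ ^ 2 ∂ν := by
  have := eLpNorm_nnreal_pow_eq_lintegral (f := f) (μ := ν) (p := 2) (by norm_num)
  simpa using this

/-- Conditional expectation fixes `g` and contracts `L²`, so the triangle inequality gives the
factor `2`. It is not sharp, but harmless for a limit equal to zero. -/
theorem eLpNorm_sub_condExp_le {α E : Type*} {m m₀ : MeasurableSpace α} {ν : Measure α}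
    [IsFiniteMeasure ν] [NormedAddCommGroup E] [NormedSpace ℝ E] [CompleteSpace E]
    (hm : m ≤ m₀) {f g : α → E} (hf : MemLp f 2 ν) (hg : MemLp g 2 ν)
    (hgm : StronglyMeasurable[m] g) :
    eLpNorm (f - ν[f | m]) 2 ν ≤ 2 * eLpNorm (f - g) 2 ν := by
  have hf1 := hf.integrable one_le_two
  have hg1 := hg.integrable one_le_two
  have h : f - ν[f | m] =ᵐ[ν] (f - g) - ν[f - g | m] := by
    filter_upwards [condExp_sub hf1 hg1 m] with x hx
    rw [Pi.sub_apply, Pi.sub_apply, hx, condExp_of_stronglyMeasurable hm hgm hg1]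
    simp
  rw [eLpNorm_congr_ae h, two_mul]
  exact (eLpNorm_sub_le (hf.sub hg).1 integrable_condExp.1 one_le_two).trans
    (add_le_add_right (eLpNorm_condExp_le_eLpNorm _ one_le_two) _)

/-- Rescaling a fixed standard noise moves `v` from the measure into the integrand, ready for
dominated convergence. -/
theorem jointMMSE_le {Q : Measure (PairVec n₁ n₂)} [IsProbabilityMeasure Q] (hQ : MemLp id 2 Q)
    (Φ₁ : Matrix (Fin m₁) (Fin n₁) ℝ) (Φ₂ : Matrix (Fin m₂) (Fin n₂) ℝ) {v : ℝ} (hv : 0 ≤ v)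
    (f : BoundedContinuousFunction (PairVec m₁ m₂) (PairVec n₁ n₂)) :
    jointMMSE Q Φ₁ Φ₂ v ≤ 4 * ∫⁻ xz, ‖xz.1 - f (blockMap Φ₁ Φ₂ xz.1 + √v • xz.2)‖ₑ ^ 2
      ∂(Q.prod (stdGaussian (PairVec m₁ m₂))) := by
  have hnoise : noiseLaw m₁ m₂ v = (stdGaussian (PairVec m₁ m₂)).map fun z => √v • z :=
    multivariateGaussian_zero_smul_one hv
  have : IsProbabilityMeasure (noiseLaw m₁ m₂ v) := by
    rw [noiseLaw]; infer_instance
  have hc := continuous_observe Φ₁ Φ₂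
  have hx : MemLp (fun xw : PairVec n₁ n₂ × PairVec m₁ m₂ => xw.1) 2
      (Q.prod (noiseLaw m₁ m₂ v)) := hQ.comp_fst _
  have hfm : StronglyMeasurable[MeasurableSpace.comap (observe Φ₁ Φ₂) inferInstance]
      (fun xw => f (observe Φ₁ Φ₂ xw)) :=
    f.continuous.stronglyMeasurable.comp_measurable (comap_measurable _)
  have hf : MemLp (fun xw => f (observe Φ₁ Φ₂ xw)) 2 (Q.prod (noiseLaw m₁ m₂ v)) :=
    MemLp.of_bound (f.continuous.comp hc).aestronglyMeasurable ‖f‖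
      (ae_of_all _ fun xw => f.norm_coe_le_norm _)
  have key := eLpNorm_sub_condExp_le hc.measurable.comap_le hx hf hfm
  have hmap : Q.prod (noiseLaw m₁ m₂ v) = (Q.prod (stdGaussian (PairVec m₁ m₂))).map
      fun xz => (xz.1, √v • xz.2) := by
    rw [hnoise]
    conv_lhs => rw [← Measure.map_id (μ := Q)]
    exact Measure.map_prod_map _ _ measurable_id (by fun_prop)
  calc jointMMSE Q Φ₁ Φ₂ v = _ := (eLpNorm_two_sq _ _).symm
    _ ≤ _ := pow_le_pow_left₀ (zero_le) key 2
    _ = _ := by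
      rw [mul_pow, eLpNorm_two_sq, hmap, lintegral_map]
      · norm_num; rfl
      · exact (by fun_prop : Continuous fun xw : PairVec n₁ n₂ × PairVec m₁ m₂ =>
          ‖xw.1 - f (observe Φ₁ Φ₂ xw)‖ₑ ^ 2).measurable
      · fun_prop

theorem tendsto_lintegral_sub_comp_noise {Q : Measure (PairVec n₁ n₂)} [IsProbabilityMeasure Q]
    (hQ : MemLp id 2 Q) (T : PairVec n₁ n₂ →L[ℝ] PairVec m₁ m₂)
    (f : BoundedContinuousFunction (PairVec m₁ m₂) (PairVec n₁ n₂)) :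
    Tendsto (fun v : ℝ => ∫⁻ xz, ‖xz.1 - f (T xz.1 + √v • xz.2)‖ₑ ^ 2
      ∂(Q.prod (stdGaussian (PairVec m₁ m₂)))) (𝓝[>] 0)
      (𝓝 (∫⁻ x, ‖x - f (T x)‖ₑ ^ 2 ∂Q)) := by
  have hlim : ∫⁻ x, ‖x - f (T x)‖ₑ ^ 2 ∂Q = ∫⁻ xz, ‖xz.1 - f (T xz.1)‖ₑ ^ 2
      ∂(Q.prod (stdGaussian (PairVec m₁ m₂))) := by
    refine (measurePreserving_fst.lintegral_comp ?_).symm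
    exact (by fun_prop : Continuous fun x : PairVec n₁ n₂ => ‖x - f (T x)‖ₑ ^ 2).measurable
  rw [hlim]
  have hx : MemLp (fun xz : PairVec n₁ n₂ × PairVec m₁ m₂ => ‖xz.1‖ + ‖f‖) 2
      (Q.prod (stdGaussian (PairVec m₁ m₂))) :=
    ((hQ.comp_fst (stdGaussian (PairVec m₁ m₂))).norm).add (memLp_const ‖f‖)
  refine tendsto_lintegral_filter_of_dominated_convergence
    (fun xz => ‖‖xz.1‖ + ‖f‖‖ₑ ^ 2) ?_ ?_ ?_ ?_
  · refine Eventually.of_forall fun v => ?_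
    exact (by fun_prop : Continuous fun xz : PairVec n₁ n₂ × PairVec m₁ m₂ =>
      ‖xz.1 - f (T xz.1 + √v • xz.2)‖ₑ ^ 2).measurable
  · refine Eventually.of_forall fun v => ae_of_all _ fun xz => ?_
    gcongr
    rw [enorm_le_iff_norm_le, Real.norm_of_nonneg (by positivity)]
    exact (norm_sub_le _ _).trans (add_le_add_right (f.norm_coe_le_norm _) _)
  · rw [← eLpNorm_two_sq]
    exact ENNReal.pow_ne_top hx.2.ne
  · refine ae_of_all _ fun xz => ?_
    have hc : Continuous fun v : ℝ => ‖xz.1 - f (T xz.1 + √v • xz.2)‖ₑ ^ 2 := by fun_prop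
    have := hc.tendsto 0
    simp only [Real.sqrt_zero, zero_smul, add_zero] at this
    exact this.mono_left nhdsWithin_le_nhds

/-- Lusin–Souslin: an injective Borel map on a standard Borel space is a measurable embedding. -/
theorem exists_measurable_leftInverse {α β : Type*} [TopologicalSpace α] [PolishSpace α]
    [MeasurableSpace α] [BorelSpace α] [TopologicalSpace β] [T2Space β] [SecondCountableTopology β]
    [MeasurableSpace β] [BorelSpace β] [Nonempty α] {T : α → β} (hT : Measurable T) {G : Set α}
    (hG : MeasurableSet G) (hinj : Set.InjOn T G) :
    ∃ g : β → α, Measurable g ∧ ∀ x ∈ G, g (T x) = x := by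
  have := hG.standardBorel
  have hemb : MeasurableEmbedding (G.domRestrict T) :=
    (hT.comp measurable_subtype_coe).measurableEmbedding (hinj.injective)
  obtain ⟨g, hg, hgT⟩ := hemb.exists_measurable_extend measurable_subtype_coe
    fun _ => inferInstance
  exact ⟨g, hg, fun x hx => congrFun hgT ⟨x, hx⟩⟩

theorem exists_boundedContinuous_lintegral_lt {Q : Measure (PairVec n₁ n₂)}
    [IsProbabilityMeasure Q] (hQ : MemLp id 2 Q) (T : PairVec n₁ n₂ →L[ℝ] PairVec m₁ m₂)
    {G : Set (PairVec n₁ n₂)} (hG : MeasurableSet G) (hQG : ∀ᵐ x ∂Q, x ∈ G)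
    (hinj : Set.InjOn T G) {ε : ℝ≥0∞} (hε : 0 < ε) :
    ∃ f : BoundedContinuousFunction (PairVec m₁ m₂) (PairVec n₁ n₂),
      4 * ∫⁻ x, ‖x - f (T x)‖ₑ ^ 2 ∂Q < ε := by
  obtain ⟨g, hg, hgT⟩ := exists_measurable_leftInverse T.continuous.measurable hG hinj
  have hgT' : g ∘ T =ᵐ[Q] id := by
    filter_upwards [hQG] with x hx using hgT x hx
  have hgL : MemLp g 2 (Q.map T) := by
    rw [memLp_map_measure_iff hg.aestronglyMeasurable T.continuous.aemeasurable]
    exact (memLp_congr_ae hgT').2 hQ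
  have hlim : Tendsto (fun δ : ℝ≥0∞ => 4 * δ ^ 2) (𝓝[>] 0) (𝓝 0) := by
    have : Continuous fun δ : ℝ≥0∞ => 4 * δ ^ 2 :=
      (ENNReal.continuous_const_mul (by norm_num)).comp (ENNReal.continuous_pow 2)
    exact (this.tendsto' 0 0 (by simp)).mono_left nhdsWithin_le_nhds
  obtain ⟨δ, hδ, hδ0⟩ := ((hlim.eventually_lt_const hε).and self_mem_nhdsWithin).exists
  have : IsProbabilityMeasure (Q.map T) :=
    Measure.isProbabilityMeasure_map T.continuous.aemeasurable
  obtain ⟨f, hf, -⟩ := hgL.exists_boundedContinuous_eLpNorm_sub_le (by norm_num)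
    (ne_of_gt hδ0 : δ ≠ 0)
  refine ⟨f, lt_of_le_of_lt ?_ hδ⟩
  rw [← eLpNorm_two_sq]
  gcongr
  refine le_trans (le_of_eq ?_) hf
  rw [eLpNorm_map_measure (hg.sub f.continuous.measurable).aestronglyMeasurable
    T.continuous.aemeasurable]
  refine eLpNorm_congr_ae ?_
  filter_upwards [hgT'] with x hx
  simp only [Function.comp_apply, id_eq] at hx
  simp [hx]

/-- In the low-noise limit the MMSE vanishes as soon as the noiseless observation is injective on
a set of full measure. -/
theorem tendsto_jointMMSE_zero {Q : Measure (PairVec n₁ n₂)} [IsProbabilityMeasure Q]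
    (hQ : MemLp id 2 Q) (Φ₁ : Matrix (Fin m₁) (Fin n₁) ℝ) (Φ₂ : Matrix (Fin m₂) (Fin n₂) ℝ)
    {G : Set (PairVec n₁ n₂)} (hG : MeasurableSet G) (hQG : ∀ᵐ x ∂Q, x ∈ G)
    (hinj : Set.InjOn (blockMap Φ₁ Φ₂) G) :
    Tendsto (fun v : ℝ => jointMMSE Q Φ₁ Φ₂ v) (𝓝[>] 0) (𝓝 0) := by
  rw [ENNReal.tendsto_nhds_zero]
  intro ε hε
  obtain ⟨f, hf⟩ := exists_boundedContinuous_lintegral_lt hQ (blockMap Φ₁ Φ₂) hG hQG hinj hε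
  have hlim := ENNReal.Tendsto.const_mul (a := 4)
    (tendsto_lintegral_sub_comp_noise hQ (blockMap Φ₁ Φ₂) f) (Or.inr (by norm_num))
  filter_upwards [hlim.eventually_lt_const hf, self_mem_nhdsWithin] with v hv hv0
  exact (jointMMSE_le hQ Φ₁ Φ₂ (le_of_lt hv0) f).trans hv.le

end LowNoise

/-! ### Rank conditions and separation of the mixture components -/

section Mixture

variable {m₁ m₂ n₁ n₂ : ℕ}

/-- The projection `x ↦ x₁`. -/
noncomputable def fstVec (n₁ n₂ : ℕ) : PairVec n₁ n₂ →ₗ[ℝ] (Fin n₁ → ℝ) where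
  toFun x i := x (Sum.inl i)
  map_add' _ _ := rfl
  map_smul' _ _ := rfl

/-- The projection `x ↦ x₂`. -/
noncomputable def sndVec (n₁ n₂ : ℕ) : PairVec n₁ n₂ →ₗ[ℝ] (Fin n₂ → ℝ) where
  toFun x i := x (Sum.inr i)
  map_add' _ _ := rfl
  map_smul' _ _ := rfl

theorem ker_fstVec_inf_ker_sndVec :
    LinearMap.ker (fstVec n₁ n₂) ⊓ LinearMap.ker (sndVec n₁ n₂) = ⊥ := by
  rw [eq_bot_iff]
  rintro x ⟨h₁, h₂⟩
  ext (i | i)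
  · exact congrFun h₁ i
  · exact congrFun h₂ i

theorem ofLp_blockMap (Φ₁ : Matrix (Fin m₁) (Fin n₁) ℝ) (Φ₂ : Matrix (Fin m₂) (Fin n₂) ℝ)
    (x : PairVec n₁ n₂) :
    (blockMap Φ₁ Φ₂ x).ofLp = Sum.elim (Φ₁ *ᵥ fstVec n₁ n₂ x) (Φ₂ *ᵥ sndVec n₁ n₂ x) := by
  have h : (blockMap Φ₁ Φ₂ x).ofLp = Matrix.fromBlocks Φ₁ 0 0 Φ₂ *ᵥ x.ofLp := rfl
  rw [h, Matrix.fromBlocks_mulVec]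
  simp only [Matrix.zero_mulVec, add_zero, zero_add]
  rfl

theorem finrank_inf_ker_add_finrank_map {E F : Type*} [AddCommGroup E] [Module ℝ E]
    [FiniteDimensional ℝ E] [AddCommGroup F] [Module ℝ F] (L : E →ₗ[ℝ] F) (W : Submodule ℝ E) :
    Module.finrank ℝ (W ⊓ LinearMap.ker L : Submodule ℝ E) + Module.finrank ℝ (W.map L) =
      Module.finrank ℝ W := by
  have h := LinearMap.finrank_range_add_finrank_ker (L.domRestrict W)
  rw [LinearMap.range_domRestrict] at h
  have h' : Module.finrank ℝ (LinearMap.ker (L.domRestrict W)) =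
      Module.finrank ℝ (W ⊓ LinearMap.ker L : Submodule ℝ E) := by
    rw [← Submodule.map_comap_subtype, Submodule.finrank_map_subtype_eq]
    rfl
  omega

/-- Applied to `(0, z)`, `S` gives a vector of the support direction whose second part is `S₂₂ z`.
-/
theorem rank_toBlocks₂₂_le {S : Matrix (Fin n₁ ⊕ Fin n₂) (Fin n₁ ⊕ Fin n₂) ℝ}
    (hS : S.PosSemidef) :
    S.toBlocks₂₂.rank ≤ Module.finrank ℝ ((gaussianDirection S).map (sndVec n₁ n₂)) := by
  apply Submodule.finrank_mono
  rintro _ ⟨z, rfl⟩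
  refine ⟨Matrix.toEuclideanCLM (𝕜 := ℝ) S (WithLp.toLp 2 (Sum.elim 0 z)),
    range_toEuclideanCLM_le_gaussianDirection hS ⟨_, rfl⟩, ?_⟩
  ext i
  change (S *ᵥ Sum.elim 0 z) (Sum.inr i) = (S.toBlocks₂₂ *ᵥ z) i
  simp [Matrix.mulVec, dotProduct, Matrix.toBlocks₂₂]

theorem rank_toBlocks₁₁_le {S : Matrix (Fin n₁ ⊕ Fin n₂) (Fin n₁ ⊕ Fin n₂) ℝ}
    (hS : S.PosSemidef) :
    S.toBlocks₁₁.rank ≤ Module.finrank ℝ ((gaussianDirection S).map (fstVec n₁ n₂)) := by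
  apply Submodule.finrank_mono
  rintro _ ⟨z, rfl⟩
  refine ⟨Matrix.toEuclideanCLM (𝕜 := ℝ) S (WithLp.toLp 2 (Sum.elim z 0)),
    range_toEuclideanCLM_le_gaussianDirection hS ⟨_, rfl⟩, ?_⟩
  ext i
  change (S *ᵥ Sum.elim z 0) (Sum.inl i) = (S.toBlocks₁₁ *ᵥ z) i
  simp [Matrix.mulVec, dotProduct, Matrix.toBlocks₁₁]

theorem finrank_sup_span_singleton_le {E : Type*} [AddCommGroup E] [Module ℝ E]
    [FiniteDimensional ℝ E] (V : Submodule ℝ E) (u : E) :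
    Module.finrank ℝ (V ⊔ Submodule.span ℝ {u} : Submodule ℝ E) ≤ Module.finrank ℝ V + 1 :=
  (Submodule.finrank_add_le_finrank_add_finrank _ _).trans
    (Nat.add_le_add_left ((finrank_span_le_card {u}).trans (by simp)) _)

/-- Generic block-diagonal observations are injective on every one-dimensional extension of the
direction of the support of a Gaussian law that satisfies the strict rank conditions. -/
theorem ae_blockMap_injOn {S : Matrix (Fin n₁ ⊕ Fin n₂) (Fin n₁ ⊕ Fin n₂) ℝ} (hS : S.PosSemidef)
    (h₁ : (S.rank : ℤ) - (S.toBlocks₂₂.rank : ℤ) < m₁)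
    (h₂ : (S.rank : ℤ) - (S.toBlocks₁₁.rank : ℤ) < m₂) (h₁₂ : S.rank < m₁ + m₂)
    (u : PairVec n₁ n₂) :
    ∀ᵐ A ∂((matrixLebesgue m₁ n₁).prod (matrixLebesgue m₂ n₂)),
      ∀ w ∈ gaussianDirection S ⊔ Submodule.span ℝ {u}, blockMap A.1 A.2 w = 0 → w = 0 := by
  have hV := finrank_gaussianDirection hS
  have hu := finrank_sup_span_singleton_le (gaussianDirection S) u
  set W := gaussianDirection S ⊔ Submodule.span ℝ {u}
  have hle : gaussianDirection S ≤ W := le_sup_left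
  have e₁ : Module.finrank ℝ (W ⊓ LinearMap.ker (fstVec n₁ n₂) : Submodule ℝ _) +
    Module.finrank ℝ (W.map (fstVec n₁ n₂)) = Module.finrank ℝ W :=
    finrank_inf_ker_add_finrank_map _ W
  have e₂ : Module.finrank ℝ (W ⊓ LinearMap.ker (sndVec n₁ n₂) : Submodule ℝ _) +
    Module.finrank ℝ (W.map (sndVec n₁ n₂)) = Module.finrank ℝ W :=
    finrank_inf_ker_add_finrank_map _ W
  have g₁ := (rank_toBlocks₁₁_le hS).trans
    (Submodule.finrank_mono (Submodule.map_mono (f := fstVec n₁ n₂) hle))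
  have g₂ := (rank_toBlocks₂₂_le hS).trans
    (Submodule.finrank_mono (Submodule.map_mono (f := sndVec n₁ n₂) hle))
  -- By rank–nullity this dimension is at most `rank S + 1 - rank S₂₂`; strictness absorbs the `1`.
  have d₁ : Module.finrank ℝ (W ⊓ LinearMap.ker (sndVec n₁ n₂) : Submodule ℝ _) ≤ m₁ := by omega
  have d₂ : Module.finrank ℝ (W ⊓ LinearMap.ker (fstVec n₁ n₂) : Submodule ℝ _) ≤ m₂ := by omega
  have d₁₂ : Module.finrank ℝ W ≤ m₁ + m₂ := by omega
  have key := ae_injOn_pair_of_finrank_le (fstVec n₁ n₂) (sndVec n₁ n₂) W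
    ker_fstVec_inf_ker_sndVec d₁ d₂ d₁₂
  rw [← Measure.ae_prod_iff_ae_ae
    (p := fun A : Matrix (Fin m₁) (Fin n₁) ℝ × Matrix (Fin m₂) (Fin n₂) ℝ =>
      ∀ w ∈ W, A.1 *ᵥ fstVec n₁ n₂ w = 0 → A.2 *ᵥ sndVec n₁ n₂ w = 0 → w = 0)
    (measurableSet_setOf_injOn_pair _ _ W)] at key
  filter_upwards [key] with A hA w hw h0
  have h := ofLp_blockMap A.1 A.2 w
  rw [h0] at h
  exact hA w hw (funext fun i => (congrFun h (Sum.inl i)).symm)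
    (funext fun i => (congrFun h (Sum.inr i)).symm)

/-- Densities and independence make the joint law absolutely continuous with respect to the product
Lebesgue measure. -/
theorem ae_of_isLeftRotationInvariant {Ω : Type*} [MeasurableSpace Ω] {P : Measure Ω}
    [IsProbabilityMeasure P] {Φ₁ : Ω → Matrix (Fin m₁) (Fin n₁) ℝ}
    {Φ₂ : Ω → Matrix (Fin m₂) (Fin n₂) ℝ} (hΦ₁ : IsLeftRotationInvariant P Φ₁)
    (hΦ₂ : IsLeftRotationInvariant P Φ₂) (hΦ : IndepFun Φ₁ Φ₂ P)
    {p : Matrix (Fin m₁) (Fin n₁) ℝ × Matrix (Fin m₂) (Fin n₂) ℝ → Prop}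
    (h : ∀ᵐ A ∂((matrixLebesgue m₁ n₁).prod (matrixLebesgue m₂ n₂)), p A) :
    ∀ᵐ ω ∂P, p (Φ₁ ω, Φ₂ ω) := by
  obtain ⟨hm₁, q₁, -, hq₁, -⟩ := hΦ₁
  obtain ⟨hm₂, q₂, -, hq₂, -⟩ := hΦ₂
  have hac : P.map (fun ω => (Φ₁ ω, Φ₂ ω)) ≪
      (matrixLebesgue m₁ n₁).prod (matrixLebesgue m₂ n₂) := by
    rw [(indepFun_iff_map_prod_eq_prod_map_map hm₁.aemeasurable hm₂.aemeasurable).1 hΦ]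
    refine Measure.AbsolutelyContinuous.prod ?_ ?_
    · rw [hq₁]; exact withDensity_absolutelyContinuous _ _
    · rw [hq₂]; exact withDensity_absolutelyContinuous _ _
  exact ae_of_ae_map (hm₁.prodMk hm₂).aemeasurable (hac.ae_le h)

variable {K₁ K₂ : ℕ} (p : PMF (Fin K₁ × Fin K₂)) (μ : Fin K₁ → Fin K₂ → PairVec n₁ n₂)
  (S : Fin K₁ → Fin K₂ → Matrix (Fin n₁ ⊕ Fin n₂) (Fin n₁ ⊕ Fin n₂) ℝ)

instance isProbabilityMeasure_gmmLaw : IsProbabilityMeasure (gmmLaw p μ S) := by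
  constructor
  simp only [gmmLaw, Measure.coe_finsetSum, Finset.sum_apply, Measure.smul_apply, measure_univ,
    smul_eq_mul, mul_one]
  rw [← Fintype.sum_prod_type, ← tsum_fintype (L := .unconditional _), p.tsum_coe]

theorem ae_gmmLaw {q : PairVec n₁ n₂ → Prop}
    (h : ∀ i k, 0 < p (i, k) → ∀ᵐ x ∂(multivariateGaussian (μ i k) (S i k)), q x) :
    ∀ᵐ x ∂(gmmLaw p μ S), q x := by
  simp only [gmmLaw, ae_finsetSum_measure_iff]
  intro i _ k _
  rcases (zero_le (a := p (i, k))).eq_or_lt with h0 | h0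
  · simp [← h0]
  · exact Measure.ae_smul_measure (h i k h0) _

theorem memLp_two_gmmLaw : MemLp id 2 (gmmLaw p μ S) := by
  rw [memLp_two_iff_integrable_sq_norm aestronglyMeasurable_id]
  simp only [gmmLaw, integrable_finsetSum_measure]
  intro i _ k _
  refine Integrable.smul_measure ?_ (p.apply_ne_top _)
  exact (memLp_two_iff_integrable_sq_norm aestronglyMeasurable_id).1 IsGaussian.memLp_two_id

/-- If a linear map is injective on the direction of the support of every component of a Gaussian
mixture, and the image of a support is only contained in the image of another when the first
support is contained in the second, then the map is injective on a set of full measure. -/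
theorem exists_measurableSet_injOn_gmmLaw (T : PairVec n₁ n₂ →L[ℝ] PairVec m₁ m₂)
    (hinj : ∀ a, 0 < p a → ∀ w ∈ gaussianDirection (S a.1 a.2), T w = 0 → w = 0)
    (hsep : ∀ a b, 0 < p a → 0 < p b →
      (∃ x, x - μ a.1 a.2 ∈ gaussianDirection (S a.1 a.2) ∧
        x - μ b.1 b.2 ∉ gaussianDirection (S b.1 b.2)) →
      ∃ x, x - μ a.1 a.2 ∈ gaussianDirection (S a.1 a.2) ∧
        T x - T (μ b.1 b.2) ∉ (gaussianDirection (S b.1 b.2)).map T.toLinearMap) :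
    ∃ G : Set (PairVec n₁ n₂), MeasurableSet G ∧ (∀ᵐ x ∂(gmmLaw p μ S), x ∈ G) ∧
      Set.InjOn T G := by
  have hV : ∀ a : Fin K₁ × Fin K₂, Measurable fun x =>
      x - μ a.1 a.2 ∈ gaussianDirection (S a.1 a.2) := fun a =>
    measurableSet_setOfPred.1 (((gaussianDirection (S a.1 a.2)).closed_of_finiteDimensional.preimage
      (by fun_prop : Continuous fun x => x - μ a.1 a.2)).measurableSet)
  have hTV : ∀ a : Fin K₁ × Fin K₂, Measurable fun x =>
      T x - T (μ a.1 a.2) ∈ (gaussianDirection (S a.1 a.2)).map T.toLinearMap := fun a =>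
    measurableSet_setOfPred.1 ((((gaussianDirection
      (S a.1 a.2)).map T.toLinearMap).closed_of_finiteDimensional.preimage
      (by fun_prop : Continuous fun x => T x - T (μ a.1 a.2))).measurableSet)
  -- `G` keeps the points of the supports that lie in every support `b` whose image contains their
  -- image.
  refine ⟨{x | ∃ a, 0 < p a ∧ x - μ a.1 a.2 ∈ gaussianDirection (S a.1 a.2) ∧
    ∀ b, 0 < p b → T x - T (μ b.1 b.2) ∈ (gaussianDirection (S b.1 b.2)).map T.toLinearMap →
      x - μ b.1 b.2 ∈ gaussianDirection (S b.1 b.2)}, ?_, ?_, ?_⟩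
  · refine measurableSet_setOfPred.2 (Measurable.exists fun a => measurable_const.and
      ((hV a).and (Measurable.forall fun b => measurable_const.imp ((hTV b).imp (hV b)))))
  · refine ae_gmmLaw p μ S fun i k hik => ?_
    have hall : ∀ᵐ x ∂(multivariateGaussian (μ i k) (S i k)), ∀ b, 0 < p b →
        T x - T (μ b.1 b.2) ∈ (gaussianDirection (S b.1 b.2)).map T.toLinearMap →
        x - μ b.1 b.2 ∈ gaussianDirection (S b.1 b.2) := by
      refine ae_all_iff.2 fun b => ?_
      by_cases hb : 0 < p b
      · by_cases hsub : ∃ x, x - μ i k ∈ gaussianDirection (S i k) ∧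
            x - μ b.1 b.2 ∉ gaussianDirection (S b.1 b.2)
        · obtain ⟨x₀, hx₀, hT⟩ := hsep (i, k) b hik hb hsub
          filter_upwards [ae_multivariateGaussian_notMem (μ i k) (S i k) T _ _ hx₀ hT]
            with x hx _ h using absurd h hx
        · push Not at hsub
          filter_upwards [ae_multivariateGaussian_sub_mem (μ i k) (S i k)] with x hx _ _
            using hsub x hx
      · exact ae_of_all _ fun x h => absurd h hb
    filter_upwards [hall, ae_multivariateGaussian_sub_mem (μ i k) (S i k)] with x hx hx'
    exact ⟨(i, k), hik, hx', hx⟩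
  · rintro x ⟨a, ha, hxa, hx⟩ y ⟨b, hb, hyb, hy⟩ hxy
    have hxb : x - μ b.1 b.2 ∈ gaussianDirection (S b.1 b.2) :=
      hx b hb ⟨y - μ b.1 b.2, hyb, by simp [hxy]⟩
    refine sub_eq_zero.1 (hinj b hb (x - y) ?_ (by rw [map_sub, hxy, sub_self]))
    simpa using Submodule.sub_mem _ hxb hyb

end Mixture

theorem theorem8 {Ω : Type*} [MeasurableSpace Ω] (P : Measure Ω) [IsProbabilityMeasure P]
    {K₁ K₂ n₁ n₂ m₁ m₂ : ℕ}
    (p : PMF (Fin K₁ × Fin K₂))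
    (μ : Fin K₁ → Fin K₂ → PairVec n₁ n₂)
    (S : Fin K₁ → Fin K₂ → Matrix (Fin n₁ ⊕ Fin n₂) (Fin n₁ ⊕ Fin n₂) ℝ)
    (hS : ∀ i k, (S i k).PosSemidef)
    (Φ₁ : Ω → Matrix (Fin m₁) (Fin n₁) ℝ) (Φ₂ : Ω → Matrix (Fin m₂) (Fin n₂) ℝ)
    (hΦ₁ : IsLeftRotationInvariant P Φ₁) (hΦ₂ : IsLeftRotationInvariant P Φ₂)
    (hΦ : IndepFun Φ₁ Φ₂ P) :
    ∀ᵐ ω ∂P,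
      (∀ i k, 0 < p (i, k) →
        ((S i k).rank : ℤ) - ((S i k).toBlocks₂₂.rank : ℤ) < m₁ ∧
        ((S i k).rank : ℤ) - ((S i k).toBlocks₁₁.rank : ℤ) < m₂ ∧
        (S i k).rank < m₁ + m₂) →
      Tendsto (fun v : ℝ => jointMMSE (gmmLaw p μ S) (Φ₁ ω) (Φ₂ ω) v) (𝓝[>] 0) (𝓝 0) := by
  -- The rank conditions do not involve `ω`, so they can be settled before the null set is chosen.
  by_cases hrank : ∀ i k, 0 < p (i, k) →
      ((S i k).rank : ℤ) - ((S i k).toBlocks₂₂.rank : ℤ) < m₁ ∧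
      ((S i k).rank : ℤ) - ((S i k).toBlocks₁₁.rank : ℤ) < m₂ ∧
      (S i k).rank < m₁ + m₂
  swap
  · exact ae_of_all _ fun ω h => absurd h hrank
  have hex : ∀ a b : Fin K₁ × Fin K₂, ∃ x₀,
      (∃ x, x - μ a.1 a.2 ∈ gaussianDirection (S a.1 a.2) ∧
        x - μ b.1 b.2 ∉ gaussianDirection (S b.1 b.2)) →
      x₀ - μ a.1 a.2 ∈ gaussianDirection (S a.1 a.2) ∧
        x₀ - μ b.1 b.2 ∉ gaussianDirection (S b.1 b.2) := fun a b => by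
    by_cases h : ∃ x, x - μ a.1 a.2 ∈ gaussianDirection (S a.1 a.2) ∧
        x - μ b.1 b.2 ∉ gaussianDirection (S b.1 b.2)
    · exact ⟨h.choose, fun _ => h.choose_spec⟩
    -- A dummy point when support `a` lies in support `b`.
    · exact ⟨0, fun h' => absurd h' h⟩
  choose x₀ hx₀ using hex
  have hgen : ∀ᵐ ω ∂P, ∀ a b : Fin K₁ × Fin K₂, 0 < p b →
      ∀ w ∈ gaussianDirection (S b.1 b.2) ⊔ Submodule.span ℝ {x₀ a b - μ b.1 b.2},
        blockMap (Φ₁ ω) (Φ₂ ω) w = 0 → w = 0 := by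
    refine ae_all_iff.2 fun a => ae_all_iff.2 fun b => ?_
    by_cases hb : 0 < p b
    · obtain ⟨h₁, h₂, h₁₂⟩ := hrank b.1 b.2 hb
      filter_upwards [ae_of_isLeftRotationInvariant hΦ₁ hΦ₂ hΦ
        (ae_blockMap_injOn (hS b.1 b.2) h₁ h₂ h₁₂ (x₀ a b - μ b.1 b.2))] with ω hω _ using hω
    · exact ae_of_all _ fun ω h => absurd h hb
  filter_upwards [hgen] with ω hω _
  obtain ⟨G, hG, hQG, hinj⟩ := exists_measurableSet_injOn_gmmLaw p μ S (blockMap (Φ₁ ω) (Φ₂ ω))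
    (fun b hb w hw => hω b b hb w (le_sup_left (a := gaussianDirection (S b.1 b.2)) hw))
    (fun a b _ hb h => by
      obtain ⟨hxa, hxb⟩ := hx₀ a b h
      refine ⟨x₀ a b, hxa, ?_⟩
      rintro ⟨w, hw, hTw⟩
      apply hxb
      -- The extra dimension is used here: this difference lies in `V b ⊔ span {x₀ - μ b}`, where
      -- `T` is injective.
      have h0 : w - (x₀ a b - μ b.1 b.2) = 0 := by
        refine hω a b hb _ (Submodule.sub_mem _ (Submodule.mem_sup_left hw)
          (Submodule.mem_sup_right (Submodule.mem_span_singleton_self _))) ?_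
        rw [map_sub, map_sub, ← hTw]
        exact sub_self _
      rwa [← sub_eq_zero.1 h0])
  exact tendsto_jointMMSE_zero (memLp_two_gmmLaw p μ S) _ _ hG hQG hinj
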